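/- Let $h\colon[-e^{-1},e^{-1}]\to\mathbb R$ be given by $h(0)=0$ and $h(x)=|x|\,\bigl(\log\bigl|\log\frac{|x|}{e}\bigr|\bigr)^{-1/2}$ for $x\neq 0$, extend it to a $2\pi$-periodic $C^1$ function $h\colon\mathbb R\to\mathbb R$ (any such extension), and let $g$ be the function on the unit circle $\mathbb T\subset\mathbb C$ with $g(e^{i\theta})=h(\theta)$ for all $\theta\in\mathbb R$. Then there is a constant $c>0$, not depending on $n$, such that for every integer $n\ge 3$ there exist unitary operators $H_n,K_n$ on the Hilbert space $\ell^2_{2n+1}=\mathbb C^{2n+1}$ with $$H_n\neq K_n,\qquad \sigma(H_n)=\sigma(K_n),\qquad 1\in\sigma(H_n),$$ and $$\|g(K_n)-g(H_n)\|\ \ge\ c\,(\log n)^{1/2}\,\|K_n-H_n\|,$$ where $\sigma$ denotes the spectrum, $g(\cdot)$ is defined by the functional calculus for normal operators, and $\|\cdot\|$ is the operator norm. -/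

import Mathlib

/-- The function `x ↦ |x| (log |log (|x| / e)|)^(-1/2)`, with value `0` at `0`.
Only its values on `[-e⁻¹, e⁻¹]` are used; there `|log (|x| / e)| ≥ 2` for `x ≠ 0`. -/
noncomputable def hLocal (x : ℝ) : ℝ :=
  if x = 0 then 0
  else |x| * (Real.log |Real.log (|x| / Real.exp 1)|) ^ (-(1 / 2) : ℝ)

/-- `h` is a `2π`-periodic `C¹` extension of the restriction of `hLocal` to `[-e⁻¹, e⁻¹]`. -/
structure IsPeriodicExtension (h : ℝ → ℝ) : Prop where
  contDiff : ContDiff ℝ 1 h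
  periodic : Function.Periodic h (2 * Real.pi)
  eqOn : Set.EqOn h hLocal (Set.Icc (-(Real.exp 1)⁻¹) (Real.exp 1)⁻¹)

/-- The bounded operators on `ℓ²_N`, i.e. on `ℂ^N` with its Euclidean norm. -/
abbrev OpEll2 (N : ℕ) : Type :=
  EuclideanSpace ℂ (Fin N) →L[ℂ] EuclideanSpace ℂ (Fin N)

/-! The function `h` is even, and like `|x|` it fails to be operator Lipschitz: across the origin
its divided difference behaves like a sign, which acts as triangular truncation. Take `H` diagonal
with eigenvalues `exp (i θ_a)`, `|a| ≤ n`, where `θ_a = sign(a) e^{-|a|}`. A self-adjoint `X`,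
supported on index pairs of opposite sign, is chosen so that `[X, H]` is a Hilbert matrix `1/(a+b)`
up to unimodular phases; its norm is at most `π` for every `n` (`hilbert_inequality`,
`norm_commutator_unitary_le`). In `[X, g(H)]` the entry at `(j, -k)` becomes nonnegative and
dominates a multiple of `(log (n+1))^{-1/2} / |j-k|`. The signs that kept the Hilbert matrix bounded
are gone, so each row sums to order `log n`, and testing on indicator vectors gives norm at least of
order `(log n)^{1/2}` (`log_le_norm_commutator`). Finally `exists_unitary_conj_commutator` gives one
unitary `u`, a Cayley transform of a small multiple of `X`, for which `‖u y u* - y‖` is comparable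
to `t ‖[X, y]‖` for all `y` at once. With `K = u H u*` the spectrum is unchanged, `g(K) = u g(H)
u*`, and `t` cancels from the ratio. -/

/-! ### Hilbert's inequality from the Fourier coefficients of a sawtooth -/

theorem integral_exp_int_mul (m : ℤ) :
    ∫ t in (0 : ℝ)..2 * Real.pi, Complex.exp (Complex.I * m * t) =
      if m = 0 then 2 * (Real.pi : ℂ) else 0 := by
  split_ifs with hm
  · subst hm; simp
  · have hc : Complex.I * (m : ℂ) ≠ 0 := by simp [hm]
    rw [integral_exp_mul_complex hc]
    have : Complex.I * (m : ℂ) * ((2 * Real.pi : ℝ) : ℂ) = m * (2 * Real.pi * Complex.I) := by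
      push_cast; ring
    rw [this, Complex.exp_int_mul_two_pi_mul_I]
    simp

/-- The sawtooth `t - π` is bounded by `π` and has Fourier coefficients proportional to `1/m`. Its
mean is zero, which matches the convention `1/0 = 0`, so no frequency needs excluding. -/
theorem integral_sub_pi_mul_exp_int_mul (m : ℤ) :
    ∫ t in (0 : ℝ)..2 * Real.pi, ((t : ℂ) - Real.pi) * Complex.exp (Complex.I * m * t) =
      2 * Real.pi / Complex.I * (1 / (m : ℂ)) := by
  by_cases hm : m = 0
  · subst hm
    have : ∀ t : ℝ, ((t : ℂ) - Real.pi) * Complex.exp (Complex.I * (0 : ℤ) * t) =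
        ((t - Real.pi : ℝ) : ℂ) := by intro t; simp
    simp_rw [this]
    rw [intervalIntegral.integral_ofReal]
    simp [intervalIntegral.integral_sub]
    ring_nf
  · have hm' : (m : ℂ) ≠ 0 := by exact_mod_cast hm
    have hI := Complex.I_ne_zero
    have hd : ∀ t ∈ Set.uIcc 0 (2 * Real.pi), HasDerivAt
        (fun t : ℝ => (((t : ℂ) - Real.pi) / (Complex.I * m) + 1 / (m : ℂ) ^ 2) *
          Complex.exp (Complex.I * m * t))
        (((t : ℂ) - Real.pi) * Complex.exp (Complex.I * m * t)) t := by
      intro t _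
      have h0 : HasDerivAt (fun t : ℝ => (t : ℂ)) 1 t := Complex.ofRealCLM.hasDerivAt
      have h1 := ((h0.sub_const (Real.pi : ℂ)).div_const (Complex.I * m)).add_const
        (1 / (m : ℂ) ^ 2)
      have h2 := (h0.const_mul (Complex.I * m)).cexp
      refine (h1.mul h2).congr_deriv ?_
      field_simp
      linear_combination Complex.I_sq
    rw [intervalIntegral.integral_eq_sub_of_hasDerivAt hd
      (Continuous.intervalIntegrable (by fun_prop) _ _)]
    have : Complex.I * (m : ℂ) * ((2 * Real.pi : ℝ) : ℂ) = m * (2 * Real.pi * Complex.I) := by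
      push_cast; ring
    rw [this, Complex.exp_int_mul_two_pi_mul_I]
    push_cast
    simp only [mul_zero, Complex.exp_zero]
    field_simp
    ring

/-- The trigonometric polynomial with coefficients `p` at the frequencies `m`. -/
noncomputable def trigPoly {ι : Type*} [Fintype ι] (m : ι → ℤ) (p : ι → ℂ) (t : ℝ) : ℂ :=
  ∑ a, p a * Complex.exp (Complex.I * m a * t)

theorem continuous_trigPoly {ι : Type*} [Fintype ι] (m : ι → ℤ) (p : ι → ℂ) :
    Continuous (trigPoly m p) := by
  unfold trigPoly; fun_prop

theorem integral_norm_sq_trigPoly {ι : Type*} [Fintype ι] {m : ι → ℤ}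
    (hm : Function.Injective m) (p : ι → ℂ) :
    ∫ t in (0 : ℝ)..2 * Real.pi, ‖trigPoly m p t‖ ^ 2 = 2 * Real.pi * ∑ a, ‖p a‖ ^ 2 := by
  classical
  apply Complex.ofReal_injective
  rw [← intervalIntegral.integral_ofReal]
  have h : ∀ t : ℝ, ((‖trigPoly m p t‖ ^ 2 : ℝ) : ℂ) =
      ∑ a, ∑ b, p a * (starRingEnd ℂ) (p b) *
        Complex.exp (Complex.I * ((m a - m b : ℤ) : ℂ) * t) := by
    intro t
    push_cast
    rw [← Complex.mul_conj', trigPoly, map_sum, Finset.sum_mul_sum]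
    refine Finset.sum_congr rfl fun a _ => Finset.sum_congr rfl fun b _ => ?_
    rw [map_mul, ← Complex.exp_conj]
    simp only [map_mul, Complex.conj_I, Complex.conj_ofReal, map_intCast]
    rw [show Complex.I * ((m a : ℂ) - m b) * t
      = Complex.I * m a * t + -Complex.I * m b * t by ring, Complex.exp_add]
    ring
  simp_rw [h]
  rw [intervalIntegral.integral_finsetSum
    fun a _ => Continuous.intervalIntegrable (by fun_prop) _ _]
  rw [Complex.ofReal_mul, Complex.ofReal_sum, Finset.mul_sum]
  refine Finset.sum_congr rfl fun a _ => ?_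
  rw [intervalIntegral.integral_finsetSum
    fun a _ => Continuous.intervalIntegrable (by fun_prop) _ _]
  simp_rw [intervalIntegral.integral_const_mul, integral_exp_int_mul, sub_eq_zero, hm.eq_iff]
  simp [Complex.mul_conj']
  ring

/-- **Hilbert's inequality**, in additive form. -/
theorem hilbert_inequality {ι : Type*} [Fintype ι] {m : ι → ℤ}
    (hm : Function.Injective m) (p q : ι → ℂ) :
    ‖∑ a, ∑ b, p a * (1 / ((m a : ℂ) + m b)) * q b‖ ≤
      Real.pi / 2 * (∑ a, ‖p a‖ ^ 2 + ∑ b, ‖q b‖ ^ 2) := by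
  have hpi := Real.pi_pos
  have key : ∫ t in (0 : ℝ)..2 * Real.pi,
      ((t : ℂ) - Real.pi) * (trigPoly m p t * trigPoly m q t) =
      2 * Real.pi / Complex.I * ∑ a, ∑ b, p a * (1 / ((m a : ℂ) + m b)) * q b := by
    have h : ∀ t : ℝ, ((t : ℂ) - Real.pi) * (trigPoly m p t * trigPoly m q t) =
        ∑ a, ∑ b, p a * q b * (((t : ℂ) - Real.pi) *
          Complex.exp (Complex.I * ((m a + m b : ℤ) : ℂ) * t)) := by
      intro t
      rw [trigPoly, trigPoly, Finset.sum_mul_sum, Finset.mul_sum]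
      refine Finset.sum_congr rfl fun a _ => ?_
      rw [Finset.mul_sum]
      refine Finset.sum_congr rfl fun b _ => ?_
      push_cast
      rw [show Complex.I * ((m a : ℂ) + m b) * t
        = Complex.I * m a * t + Complex.I * m b * t by ring, Complex.exp_add]
      ring
    simp_rw [h]
    rw [intervalIntegral.integral_finsetSum
      fun a _ => Continuous.intervalIntegrable (by fun_prop) _ _, Finset.mul_sum]
    refine Finset.sum_congr rfl fun a _ => ?_
    rw [intervalIntegral.integral_finsetSum
      fun a _ => Continuous.intervalIntegrable (by fun_prop) _ _, Finset.mul_sum]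
    refine Finset.sum_congr rfl fun b _ => ?_
    rw [intervalIntegral.integral_const_mul, integral_sub_pi_mul_exp_int_mul]
    push_cast
    ring
  have bound : ‖∫ t in (0 : ℝ)..2 * Real.pi,
      ((t : ℂ) - Real.pi) * (trigPoly m p t * trigPoly m q t)‖ ≤
      ∫ t in (0 : ℝ)..2 * Real.pi,
        Real.pi / 2 * (‖trigPoly m p t‖ ^ 2 + ‖trigPoly m q t‖ ^ 2) := by
    have hp := continuous_trigPoly m p
    have hq := continuous_trigPoly m q
    refine intervalIntegral.norm_integral_le_of_norm_le (by positivity) ?_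
      (Continuous.intervalIntegrable (by fun_prop) _ _)
    refine Filter.Eventually.of_forall fun t ht => ?_
    rw [norm_mul, norm_mul]
    have h1 : ‖(t : ℂ) - Real.pi‖ ≤ Real.pi := by
      rw [← Complex.ofReal_sub, Complex.norm_real, Real.norm_eq_abs, abs_le]
      constructor <;> linarith [ht.1, ht.2]
    have h2 : ‖trigPoly m p t‖ * ‖trigPoly m q t‖ ≤
        (‖trigPoly m p t‖ ^ 2 + ‖trigPoly m q t‖ ^ 2) / 2 := by
      nlinarith [sq_nonneg (‖trigPoly m p t‖ - ‖trigPoly m q t‖)]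
    calc _ ≤ Real.pi * ((‖trigPoly m p t‖ ^ 2 + ‖trigPoly m q t‖ ^ 2) / 2) :=
          mul_le_mul h1 h2 (by positivity) hpi.le
      _ = _ := by ring
  rw [key, intervalIntegral.integral_const_mul, intervalIntegral.integral_add
    (f := fun t => ‖trigPoly m p t‖ ^ 2) (g := fun t => ‖trigPoly m q t‖ ^ 2)
    (Continuous.intervalIntegrable ((continuous_trigPoly m p).norm.pow 2) _ _)
    (Continuous.intervalIntegrable ((continuous_trigPoly m q).norm.pow 2) _ _),
    integral_norm_sq_trigPoly hm, integral_norm_sq_trigPoly hm, norm_mul] at bound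
  have h3 : ‖2 * (Real.pi : ℂ) / Complex.I‖ = 2 * Real.pi := by
    simp [abs_of_pos hpi]
  rw [h3] at bound
  refine le_of_mul_le_mul_left (bound.trans_eq ?_) (by positivity : 0 < 2 * Real.pi)
  ring

/-! ### Unitary conjugation and commutators -/

/-- Cayley transforms turn commutators with a self-adjoint element into unitary perturbations. -/
theorem exists_unitary_conj_commutator {A : Type*} [CStarAlgebra A] [Nontrivial A]
    {x : A} (hx : IsSelfAdjoint x) :
    ∃ u ∈ unitary A, ∃ t : ℝ, 0 < t ∧ ∀ y : A,
      ‖u * y * star u - y‖ ≤ 8 * (t * ‖x * y - y * x‖) ∧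
      t * ‖x * y - y * x‖ ≤ 2 * ‖u * y * star u - y‖ := by
  -- This size makes `‖a‖ ≤ 1/2` for `a = i t x`, hence `‖(1 - a)⁻¹‖ ≤ 2` and `‖1 - a‖ ≤ 3/2`.
  set t : ℝ := 1 / (2 * (1 + ‖x‖)) with ht
  have hx0 := norm_nonneg x
  have htpos : 0 < t := by positivity
  set a : A := ((Complex.I * t : ℂ)) • x with ha
  have hna : ‖a‖ ≤ 1 / 2 := by
    rw [ha, norm_smul, norm_mul, Complex.norm_I, Complex.norm_real, Real.norm_of_nonneg htpos.le,
      one_mul, ht, div_mul_eq_mul_div, one_mul, div_le_div_iff₀ (by positivity) (by norm_num)]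
    linarith
  have hsa : star a = -a := by
    rw [ha, star_smul, hx.star_eq, ← neg_smul]
    congr 1
    simp
  obtain ⟨w, hw⟩ := isUnit_one_sub_of_norm_lt_one (hna.trans_lt (by norm_num))
  set r : A := ((w⁻¹ : Aˣ) : A) with hr
  have h1 : r * (1 - a) = 1 := by rw [← hw, hr]; exact w.inv_mul
  have h2 : (1 - a) * r = 1 := by rw [← hw, hr]; exact w.mul_inv
  have h3 : (1 + a) * star r = 1 := by
    have := congrArg star h1
    simpa [hsa] using this
  have h4 : star r * (1 + a) = 1 := by
    have := congrArg star h2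
    simpa [hsa] using this
  have hnr : ‖r‖ ≤ 2 := by
    have h5 : r = 1 + r * a := by rw [mul_sub, mul_one] at h1; rw [← h1]; abel
    have h6 : ‖r‖ ≤ 1 + ‖r‖ * (1 / 2) := by
      calc ‖r‖ = ‖1 + r * a‖ := by rw [← h5]
        _ ≤ ‖(1 : A)‖ + ‖r * a‖ := norm_add_le _ _
        _ ≤ 1 + ‖r‖ * (1 / 2) := by
          rw [CStarRing.norm_one]
          gcongr
          exact (norm_mul_le _ _).trans (by gcongr)
    linarith
  have hrr : star r * r + star r * r = r + star r := by
    calc star r * r + star r * r = star r * ((1 + a) + (1 - a)) * r := by noncomm_ring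
      _ = (star r * (1 + a)) * r + star r * ((1 - a) * r) := by noncomm_ring
      _ = _ := by rw [h4, h2]; simp
  have hrr' : r * star r + r * star r = r + star r := by
    calc r * star r + r * star r = r * ((1 + a) + (1 - a)) * star r := by noncomm_ring
      _ = r * ((1 + a) * star r) + (r * (1 - a)) * star r := by noncomm_ring
      _ = _ := by rw [h3, h1]; simp
  -- With `r = (1 - a)⁻¹`, the element `2r - 1 = (1 + a)(1 - a)⁻¹` is the Cayley transform.
  obtain ⟨u, hu⟩ : ∃ u, u = r + r - 1 := ⟨_, rfl⟩
  have hsu : star u = star r + star r - 1 := by simp [hu]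
  have huu : u ∈ unitary A := by
    rw [Unitary.mem_iff, hsu, hu]
    constructor
    · calc (star r + star r - 1) * (r + r - 1)
          = (star r * r + star r * r) + (star r * r + star r * r) - (r + star r)
            - (r + star r) + 1 := by noncomm_ring
        _ = 1 := by rw [hrr]; abel
    · calc (r + r - 1) * (star r + star r - 1)
          = (r * star r + r * star r) + (r * star r + r * star r) - (r + star r)
            - (r + star r) + 1 := by noncomm_ring
        _ = 1 := by rw [hrr']; abel
  refine ⟨u, huu, t, htpos, fun y => ?_⟩
  have hnorm : ‖u * y * star u - y‖ = ‖u * y - y * u‖ := by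
    have : u * y * star u - y = (u * y - y * u) * star u := by
      rw [sub_mul, mul_assoc y, (Unitary.mem_iff.1 huu).2, mul_one]
    rw [this]
    exact CStarRing.norm_mul_mem_unitary _ (Unitary.star_mem huu)
  have hta : t * ‖x * y - y * x‖ = ‖a * y - y * a‖ := by
    rw [ha, smul_mul_assoc, mul_smul_comm, ← smul_sub, norm_smul, norm_mul, Complex.norm_I,
      Complex.norm_real, Real.norm_of_nonneg htpos.le, one_mul]
  -- The resolvent identity `[r, y] = r [a, y] r`, doubled; inverting it gives the reverse estimate.
  have hc : u * y - y * u = r * (a * y - y * a) * r + r * (a * y - y * a) * r := by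
    have : r * (a * y - y * a) * r = r * y - y * r := by
      calc r * (a * y - y * a) * r = r * y * ((1 - a) * r) - (r * (1 - a)) * y * r := by
            noncomm_ring
        _ = _ := by rw [h1, h2]; simp
    rw [this, hu]; noncomm_ring
  have hc' : (a * y - y * a) + (a * y - y * a) = (1 - a) * (u * y - y * u) * (1 - a) := by
    rw [hc]
    calc (a * y - y * a) + (a * y - y * a)
        = 1 * (a * y - y * a) * 1 + 1 * (a * y - y * a) * 1 := by simp
      _ = ((1 - a) * r) * (a * y - y * a) * (r * (1 - a))
          + ((1 - a) * r) * (a * y - y * a) * (r * (1 - a)) := by rw [h1, h2]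
      _ = _ := by noncomm_ring
  rw [hnorm, hta]
  constructor
  · have : ‖r * (a * y - y * a) * r‖ ≤ 2 * ‖a * y - y * a‖ * 2 :=
      (norm_mul_le _ _).trans (by gcongr; exact (norm_mul_le _ _).trans (by gcongr))
    rw [hc]
    linarith [norm_add_le (r * (a * y - y * a) * r) (r * (a * y - y * a) * r)]
  · have h1a : ‖1 - a‖ ≤ 3 / 2 := by
      have := norm_sub_le 1 a
      rw [CStarRing.norm_one] at this
      linarith
    have h5 : ‖(1 - a) * (u * y - y * u) * (1 - a)‖ ≤ 3 / 2 * ‖u * y - y * u‖ * (3 / 2) :=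
      (norm_mul_le _ _).trans (by gcongr; exact (norm_mul_le _ _).trans (by gcongr))
    rw [← hc', ← two_smul ℂ, norm_smul] at h5
    norm_num at h5
    linarith [norm_nonneg (u * y - y * u)]

theorem cfc_unitary_conj {A : Type*} [CStarAlgebra A] {g : ℂ → ℂ} {a u : A} (hu : u ∈ unitary A)
    (ha : IsStarNormal a) (hg : ContinuousOn g (spectrum ℂ a)) :
    cfc g (u * a * star u) = u * cfc g a * star u := by
  let φ : A →⋆ₐ[ℂ] A := (Unitary.conjStarAlgAut ℂ A ⟨u, hu⟩ : A →⋆ₐ[ℂ] A)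
  have hφ : Continuous φ := (continuous_const.mul continuous_id).mul continuous_const
  exact (StarAlgHom.map_cfc φ g a hg hφ ha (ha.map φ)).symm

/-! ### Diagonal operators and norms of matrices -/

section DiagonalOperators

variable {ι : Type*} [Fintype ι] [DecidableEq ι]

/-- The operator on `ℓ²(ι)` given by a matrix. -/
noncomputable abbrev matOp (M : Matrix ι ι ℂ) : EuclideanSpace ℂ ι →L[ℂ] EuclideanSpace ℂ ι :=
  Matrix.toEuclideanCLM (n := ι) (𝕜 := ℂ) M

/-- Diagonal operators, as a star homomorphism. -/
noncomputable def diagOp : (ι → ℂ) →⋆ₐ[ℂ] (EuclideanSpace ℂ ι →L[ℂ] EuclideanSpace ℂ ι) where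
  toAlgHom := (Matrix.toEuclideanCLM (n := ι) (𝕜 := ℂ) :
    Matrix ι ι ℂ →ₐ[ℂ] _).comp (Matrix.diagonalAlgHom ℂ)
  map_star' d := by
    change matOp (Matrix.diagonal (star d)) = star (matOp (Matrix.diagonal d))
    rw [matOp, matOp, ← map_star, Matrix.star_eq_conjTranspose, Matrix.diagonal_conjTranspose]

theorem diagOp_apply (d : ι → ℂ) : diagOp d = matOp (Matrix.diagonal d) := rfl

theorem diagOp_mem_unitary {d : ι → ℂ} (hd : ∀ i, ‖d i‖ = 1) :
    diagOp d ∈ unitary (EuclideanSpace ℂ ι →L[ℂ] EuclideanSpace ℂ ι) := by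
  have h1 : star d * d = 1 := by
    ext i
    simp [Complex.conj_mul', hd]
  rw [Unitary.mem_iff, ← map_star, ← map_mul, ← map_mul, mul_comm d, h1, map_one]
  exact ⟨rfl, rfl⟩

theorem finite_iUnion_spectrum {ι : Type*} [Finite ι] (d : ι → ℂ) : (⋃ i, spectrum ℂ (d i)).Finite := by
  refine Set.finite_iUnion fun i => ?_
  have : d i = algebraMap ℂ ℂ (d i) := rfl
  rw [this, spectrum.scalar_eq]
  exact Set.finite_singleton _

theorem finite_spectrum_diagOp (d : ι → ℂ) : (spectrum ℂ (diagOp d)).Finite := by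
  refine (finite_iUnion_spectrum d).subset ?_
  rw [← Pi.spectrum_eq]
  exact AlgHom.spectrum_apply_subset diagOp d

/-- The spectra are finite, so every `g` is continuous on them and no regularity is required. -/
theorem cfc_diagOp (g : ℂ → ℂ) (d : ι → ℂ) : cfc g (diagOp d) = diagOp (fun i => g (d i)) := by
  have hfin := finite_iUnion_spectrum d
  have hd : IsStarNormal d := ⟨mul_comm _ _⟩
  have hd' : IsStarNormal (diagOp d) := hd.map diagOp
  have h1 : cfc g d = fun i => g (d i) := by
    rw [cfc_map_pi (S := ℂ) g d (hfin.continuousOn g) hd fun i => ⟨mul_comm _ _⟩]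
    ext i
    exact cfc_algebraMap (A := ℂ) (d i) g
  have hcont : Continuous (diagOp (ι := ι)) :=
    LinearMap.continuous_of_finiteDimensional (diagOp (ι := ι)).toAlgHom.toLinearMap
  rw [← h1, StarAlgHom.map_cfc diagOp g d (by rw [Pi.spectrum_eq]; exact hfin.continuousOn g)
    hcont hd hd']

theorem mem_spectrum_diagOp (d : ι → ℂ) (i : ι) : d i ∈ spectrum ℂ (diagOp d) := by
  rw [spectrum.mem_iff]
  rintro ⟨w, hw⟩
  have h1 : (w : EuclideanSpace ℂ ι →L[ℂ] EuclideanSpace ℂ ι) (EuclideanSpace.single i 1) = 0 := by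
    rw [hw, diagOp_apply]
    ext j
    simp [Algebra.algebraMap_eq_smul_one, Pi.single_apply]
  have h2 : (↑w⁻¹ * ↑w : EuclideanSpace ℂ ι →L[ℂ] EuclideanSpace ℂ ι)
      (EuclideanSpace.single i 1) = 0 := by
    rw [mul_apply_eq_comp, h1, map_zero]
  rw [w.inv_mul] at h2
  have := congrArg (fun x : EuclideanSpace ℂ ι => x i) h2
  simp at this

theorem matOp_commutator_diagOp (X : Matrix ι ι ℂ) (d : ι → ℂ) :
    matOp X * diagOp d - diagOp d * matOp X =
      matOp (Matrix.of fun a b => X a b * (d b - d a)) := by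
  rw [diagOp_apply, matOp, matOp, ← map_mul, ← map_mul, ← map_sub]
  congr 1
  ext a b
  simp
  ring

theorem inner_matOp (M : Matrix ι ι ℂ) (u v : EuclideanSpace ℂ ι) :
    inner ℂ u (matOp M v) = ∑ a, ∑ b, (starRingEnd ℂ) (u a) * M a b * v b := by
  simp only [PiLp.inner_apply, Matrix.ofLp_toEuclideanCLM, Matrix.mulVec, dotProduct,
    RCLike.inner_apply, Finset.sum_mul]
  refine Finset.sum_congr rfl fun a _ => Finset.sum_congr rfl fun b _ => ?_
  ring

/-- The additive bound suffices: testing it on the conjugate of `C⁻¹ M v` against `v` lets half of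
`‖M v‖²` be absorbed on the left. -/
theorem norm_matOp_le {M : Matrix ι ι ℂ} {C : ℝ} (hC : 0 < C)
    (h : ∀ u v : ι → ℂ, ‖∑ a, ∑ b, u a * M a b * v b‖ ≤
      C / 2 * (∑ a, ‖u a‖ ^ 2 + ∑ b, ‖v b‖ ^ 2)) : ‖matOp M‖ ≤ C := by
  refine ContinuousLinearMap.opNorm_le_bound _ hC.le fun v => ?_
  set w := matOp M v with hw
  have h1 := h (fun a => (starRingEnd ℂ) (((C⁻¹ : ℝ) : ℂ) * w a)) v
  have h2 : ∑ a, ∑ b, (starRingEnd ℂ) (((C⁻¹ : ℝ) : ℂ) * w a) * M a b * v b =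
      ((C⁻¹ * ‖w‖ ^ 2 : ℝ) : ℂ) := by
    have h3 := inner_matOp M w v
    rw [← hw, inner_self_eq_norm_sq_to_K] at h3
    push_cast
    rw [show ((‖w‖ : ℂ)) ^ 2 = _ from h3, Finset.mul_sum]
    refine Finset.sum_congr rfl fun a _ => ?_
    rw [Finset.mul_sum]
    refine Finset.sum_congr rfl fun b _ => ?_
    simp
    ring
  have h4 : ∑ a, ‖(starRingEnd ℂ) (((C⁻¹ : ℝ) : ℂ) * w a)‖ ^ 2 = C⁻¹ ^ 2 * ‖w‖ ^ 2 := by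
    rw [EuclideanSpace.norm_sq_eq, Finset.mul_sum]
    refine Finset.sum_congr rfl fun a _ => ?_
    rw [RCLike.norm_conj, norm_mul, Complex.norm_real, Real.norm_of_nonneg (by positivity), mul_pow]
  rw [h2, h4, ← EuclideanSpace.norm_sq_eq v, Complex.norm_real,
    Real.norm_of_nonneg (by positivity)] at h1
  have h5 : C * (C⁻¹ * ‖w‖ ^ 2) = ‖w‖ ^ 2 := by field_simp
  have h6 : C * (C / 2 * (C⁻¹ ^ 2 * ‖w‖ ^ 2 + ‖v‖ ^ 2)) = ‖w‖ ^ 2 / 2 + C ^ 2 / 2 * ‖v‖ ^ 2 := by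
    field_simp
  have h7 := mul_le_mul_of_nonneg_left h1 hC.le
  rw [h5, h6] at h7
  refine abs_le_of_sq_le_sq' ?_ (by positivity) |>.2
  rw [mul_pow]
  linarith

theorem norm_sum_le_card_mul_norm_matOp (M : Matrix ι ι ℂ) (S T : Finset ι) {n : ℕ}
    (hS : S.card = n) (hT : T.card = n) :
    ‖∑ a ∈ S, ∑ b ∈ T, M a b‖ ≤ n * ‖matOp M‖ := by
  set u : Finset ι → EuclideanSpace ℂ ι := fun S => WithLp.toLp 2 fun a => if a ∈ S then 1 else 0
  have hu : ∀ S : Finset ι, S.card = n → ‖u S‖ = Real.sqrt n := by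
    intro S hS
    rw [EuclideanSpace.norm_eq, ← hS]
    congr 1
    simp [u, apply_ite (fun z : ℂ => ‖z‖)]
  have h1 : inner ℂ (u S) (matOp M (u T)) = ∑ a ∈ S, ∑ b ∈ T, M a b := by
    rw [inner_matOp]
    simp [u, Finset.sum_ite_mem]
  calc ‖∑ a ∈ S, ∑ b ∈ T, M a b‖ ≤ ‖u S‖ * ‖matOp M (u T)‖ := by
        rw [← h1]; exact norm_inner_le_norm _ _
    _ ≤ ‖u S‖ * (‖matOp M‖ * ‖u T‖) := by gcongr; exact (matOp M).le_opNorm _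
    _ = (Real.sqrt n * Real.sqrt n) * ‖matOp M‖ := by rw [hu S hS, hu T hT]; ring
    _ = _ := by rw [Real.mul_self_sqrt (Nat.cast_nonneg n)]

end DiagonalOperators

/-! ### The kernel and its bounded commutator -/

/-- The arguments of the eigenvalues: `0` and `± e^{-j}` for `j ≥ 1`. -/
noncomputable def eigAngle (a : ℤ) : ℝ := (a.sign : ℝ) * Real.exp (-|(a : ℝ)|)

/-- A symmetric kernel supported on pairs of indices of opposite sign, whose commutator with
the unitary of eigenvalue arguments `eigAngle` is essentially a Hilbert matrix. -/
noncomputable def hilbertKernel (a b : ℤ) : ℝ :=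
  if a * b < 0 then
    1 / ((a + b) * (2 * Real.sin ((Real.exp (-|(a : ℝ)|) + Real.exp (-|(b : ℝ)|)) / 2)))
  else 0

theorem hilbertKernel_comm (a b : ℤ) : hilbertKernel a b = hilbertKernel b a := by
  unfold hilbertKernel
  rw [mul_comm a b, add_comm (a : ℝ), add_comm (Real.exp (-|(a : ℝ)|))]

theorem exp_neg_abs_le_one (x : ℝ) : Real.exp (-|x|) ≤ 1 :=
  Real.exp_le_one_iff.2 (by simp)

theorem sin_half_add_exp_pos (x y : ℝ) :
    0 < Real.sin ((Real.exp (-|x|) + Real.exp (-|y|)) / 2) := by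
  have hx := exp_neg_abs_le_one x
  have hy := exp_neg_abs_le_one y
  have := Real.pi_gt_three
  exact Real.sin_pos_of_pos_of_lt_pi (by positivity) (by linarith)

theorem exp_I_mul_sub_exp_I_mul (α β : ℂ) :
    Complex.exp (Complex.I * β) - Complex.exp (Complex.I * α) =
      Complex.I * Complex.exp (Complex.I * (α / 2)) * Complex.exp (Complex.I * (β / 2)) *
        (2 * Complex.sin ((β - α) / 2)) := by
  have h := Complex.two_sin ((β - α) / 2)
  rw [h]
  have e1 : Complex.exp (Complex.I * β) = Complex.exp (Complex.I * (α / 2)) *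
      Complex.exp (Complex.I * (β / 2)) * Complex.exp ((β - α) / 2 * Complex.I) := by
    rw [← Complex.exp_add, ← Complex.exp_add]; congr 1; ring
  have e2 : Complex.exp (Complex.I * α) = Complex.exp (Complex.I * (α / 2)) *
      Complex.exp (Complex.I * (β / 2)) * Complex.exp (-((β - α) / 2) * Complex.I) := by
    rw [← Complex.exp_add, ← Complex.exp_add]; congr 1; ring
  rw [e1, e2]
  linear_combination (-Complex.exp (Complex.I * (α / 2)) * Complex.exp (Complex.I * (β / 2)) *
    (Complex.exp (-((β - α) / 2) * Complex.I) - Complex.exp ((β - α) / 2 * Complex.I))) *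
      Complex.I_sq

/-- The half-angle phases at positive indices. -/
noncomputable def posPhase (a : ℤ) : ℂ :=
  if 0 < a then Complex.exp (Complex.I * (eigAngle a / 2)) else 0

/-- The half-angle phases at negative indices. -/
noncomputable def negPhase (a : ℤ) : ℂ :=
  if a < 0 then Complex.exp (Complex.I * (eigAngle a / 2)) else 0

theorem norm_sq_posPhase_add_norm_sq_negPhase_le (a : ℤ) :
    ‖posPhase a‖ ^ 2 + ‖negPhase a‖ ^ 2 ≤ 1 := by
  have h : ‖Complex.exp (Complex.I * (eigAngle a / 2))‖ = 1 := by
    rw [mul_comm]; exact_mod_cast Complex.norm_exp_ofReal_mul_I (eigAngle a / 2)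
  unfold posPhase negPhase
  rcases lt_trichotomy a 0 with ha | ha | ha
  · simp [ha, ha.not_gt, h]
  · simp [ha]
  · simp [ha, ha.not_gt, h]

/-- A difference of unit exponentials is two half-angle phases times a sine. For opposite signs the
sine is, up to sign, the one in the kernel's denominator and cancels. On `a + b = 0` both sides
vanish because `1/0 = 0`. -/
theorem hilbertKernel_mul_sub (a b : ℤ) :
    (hilbertKernel a b : ℂ) *
      (Complex.exp (Complex.I * eigAngle b) - Complex.exp (Complex.I * eigAngle a)) =
    Complex.I * (negPhase a * (1 / ((a : ℂ) + b)) * posPhase b) -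
      Complex.I * (posPhase a * (1 / ((a : ℂ) + b)) * negPhase b) := by
  have hs := (sin_half_add_exp_pos (a : ℝ) (b : ℝ)).ne'
  have hs' : Complex.sin (((Real.exp (-|(a : ℝ)|) + Real.exp (-|(b : ℝ)|) : ℝ) : ℂ) / 2) ≠ 0 := by
    exact_mod_cast hs
  have hK : a * b < 0 → (hilbertKernel a b : ℂ) = 1 / ((a : ℂ) + b) *
      (1 / (2 * Complex.sin (((Real.exp (-|(a : ℝ)|) + Real.exp (-|(b : ℝ)|) : ℝ) : ℂ) / 2))) := by
    intro hab
    rw [hilbertKernel, if_pos hab, one_div_mul_one_div]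
    push_cast
    ring
  rcases lt_trichotomy a 0 with ha | ha | ha
  · rcases lt_or_ge 0 b with hb | hb
    · have hd : (eigAngle b : ℂ) - eigAngle a =
          ((Real.exp (-|(a : ℝ)|) + Real.exp (-|(b : ℝ)|) : ℝ) : ℂ) := by
        rw [← Complex.ofReal_sub, eigAngle, eigAngle, Int.sign_eq_neg_one_of_neg ha,
          Int.sign_eq_one_of_pos hb]
        congr 1; push_cast; ring
      rw [exp_I_mul_sub_exp_I_mul, hd, hK (mul_neg_of_neg_of_pos ha hb)]
      simp only [negPhase, posPhase, ha, hb, ha.not_gt, hb.not_gt, if_true, if_false]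
      generalize Complex.sin _ = s at *
      field_simp
      ring
    · have : ¬ a * b < 0 := not_lt.2 (mul_nonneg_of_nonpos_of_nonpos ha.le hb)
      simp [hilbertKernel, this, posPhase, hb.not_gt, ha.not_gt]
  · simp [ha, hilbertKernel, posPhase, negPhase]
  · rcases lt_or_ge b 0 with hb | hb
    · have hd : (eigAngle b : ℂ) - eigAngle a =
          -((Real.exp (-|(a : ℝ)|) + Real.exp (-|(b : ℝ)|) : ℝ) : ℂ) := by
        rw [← Complex.ofReal_sub, ← Complex.ofReal_neg, eigAngle, eigAngle,
          Int.sign_eq_neg_one_of_neg hb, Int.sign_eq_one_of_pos ha]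
        congr 1; push_cast; ring
      rw [exp_I_mul_sub_exp_I_mul, hd, hK (mul_neg_of_pos_of_neg ha hb), neg_div, Complex.sin_neg]
      simp only [negPhase, posPhase, ha, hb, ha.not_gt, hb.not_gt, if_true, if_false]
      generalize Complex.sin _ = s at *
      field_simp
      ring
    · have : ¬ a * b < 0 := not_lt.2 (mul_nonneg ha.le hb)
      simp [hilbertKernel, this, negPhase, hb.not_gt, ha.not_gt]

/-- The commutator of the kernel with the diagonal unitary is bounded uniformly in the size. -/
theorem norm_commutator_unitary_le {ι : Type*} [Fintype ι] [DecidableEq ι] {m : ι → ℤ}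
    (hm : Function.Injective m) :
    ‖matOp (Matrix.of fun a b : ι => (hilbertKernel (m a) (m b) : ℂ) *
      (Complex.exp (Complex.I * eigAngle (m b)) - Complex.exp (Complex.I * eigAngle (m a))))‖
      ≤ Real.pi := by
  refine norm_matOp_le Real.pi_pos fun u v => ?_
  have h1 := hilbert_inequality hm (fun a => u a * negPhase (m a)) (fun b => posPhase (m b) * v b)
  have h2 := hilbert_inequality hm (fun a => u a * posPhase (m a)) (fun b => negPhase (m b) * v b)
  have hsum : ∑ a, ∑ b, u a * (Matrix.of fun a b : ι => (hilbertKernel (m a) (m b) : ℂ) *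
      (Complex.exp (Complex.I * eigAngle (m b)) - Complex.exp (Complex.I * eigAngle (m a)))) a b
        * v b =
      Complex.I * (∑ a, ∑ b, u a * negPhase (m a) * (1 / ((m a : ℂ) + m b)) *
        (posPhase (m b) * v b)) -
      Complex.I * (∑ a, ∑ b, u a * posPhase (m a) * (1 / ((m a : ℂ) + m b)) *
        (negPhase (m b) * v b)) := by
    simp only [Finset.mul_sum, ← Finset.sum_sub_distrib]
    refine Finset.sum_congr rfl fun a _ => Finset.sum_congr rfl fun b _ => ?_
    rw [Matrix.of_apply, hilbertKernel_mul_sub]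
    ring
  have hu : ∀ u : ι → ℂ, ∑ a, ‖u a * negPhase (m a)‖ ^ 2 + ∑ a, ‖u a * posPhase (m a)‖ ^ 2
      ≤ ∑ a, ‖u a‖ ^ 2 := by
    intro u
    rw [← Finset.sum_add_distrib]
    refine Finset.sum_le_sum fun a _ => ?_
    rw [norm_mul, norm_mul, mul_pow, mul_pow]
    nlinarith [norm_sq_posPhase_add_norm_sq_negPhase_le (m a), sq_nonneg ‖u a‖]
  have hu1 := hu u
  have hv1 := hu v
  simp only [mul_comm (v _)] at hv1
  rw [hsum]
  refine (norm_sub_le _ _).trans ?_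
  rw [norm_mul, norm_mul, Complex.norm_I, one_mul, one_mul]
  nlinarith [Real.pi_pos]

/-! ### Logarithmic growth of the commutator with `g(H)` -/

theorem harmonic_cast_eq_sum (n : ℕ) :
    ((harmonic n : ℚ) : ℝ) = ∑ k ∈ Finset.range n, 1 / ((k : ℝ) + 1) := by
  simp [harmonic]

/-- The term `k = j` is `1/0 = 0`, and the two sides of it are harmonic sums of lengths `j` and `d =
n - j - 1`; then `(j+1)(d+1) ≥ n`. -/
theorem log_le_sum_inv_abs_sub {n j : ℕ} (hj : j < n) :
    Real.log n ≤ ∑ k ∈ Finset.range n, 1 / |(j : ℝ) - k| := by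
  obtain ⟨d, rfl⟩ : ∃ d, n = j + (d + 1) := ⟨n - j - 1, by omega⟩
  rw [Finset.sum_range_add, Finset.sum_range_succ']
  have h1 : ∑ k ∈ Finset.range j, 1 / |(j : ℝ) - k| = ((harmonic j : ℚ) : ℝ) := by
    rw [harmonic_cast_eq_sum, ← Finset.sum_range_reflect]
    refine Finset.sum_congr rfl fun k hk => ?_
    have hk' := Finset.mem_range.1 hk
    have : (j : ℝ) - ((j - 1 - k : ℕ) : ℝ) = k + 1 := by
      rw [sub_eq_iff_eq_add]; norm_cast; omega
    rw [this, abs_of_pos (by positivity)]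
  have h2 : ∑ k ∈ Finset.range d, 1 / |(j : ℝ) - ((j + (k + 1) : ℕ) : ℝ)| =
      ((harmonic d : ℚ) : ℝ) := by
    rw [harmonic_cast_eq_sum]
    refine Finset.sum_congr rfl fun k _ => ?_
    rw [abs_sub_comm, abs_of_pos] <;> push_cast
    · congr 1; ring
    · ring_nf; positivity
  rw [h1, h2]
  have h3 := log_add_one_le_harmonic j
  have h4 := log_add_one_le_harmonic d
  have h5 : Real.log ((j + (d + 1) : ℕ) : ℝ) ≤ Real.log ((j + 1 : ℕ) * (d + 1 : ℕ) : ℝ) := by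
    apply Real.log_le_log (by positivity)
    push_cast
    nlinarith [(by positivity : (0 : ℝ) ≤ (j : ℝ) * d)]
  rw [Real.log_mul (by positivity) (by positivity)] at h5
  simp only [add_zero, sub_self, abs_zero, div_zero]
  push_cast at *
  linarith

/-- The value of the function `hLocal` at `± e^{-j}`. -/
noncomputable def hValue (j : ℕ) : ℝ := Real.exp (-j) * Real.log (j + 1) ^ (-(1 / 2) : ℝ)

theorem hLocal_of_abs_eq {x : ℝ} {j : ℕ} (hx : |x| = Real.exp (-j)) : hLocal x = hValue j := by
  have hx0 : x ≠ 0 := by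
    rintro rfl
    rw [abs_zero] at hx
    exact (Real.exp_pos _).ne hx
  rw [hLocal, if_neg hx0, hx, hValue, ← Real.exp_sub, Real.log_exp, abs_of_nonpos
    (by linarith [Nat.cast_nonneg (α := ℝ) j])]
  ring_nf

/-- Geometric spacing gives `e^{-k} ≤ e^{-j}/2`, so the difference of the exponentials is at least a
third of their sum. The logarithmic factor decreases in the index, so its value at `n` is a lower
bound. -/
theorem exp_sub_mul_le_hValue_sub {n j k : ℕ} (hj : 1 ≤ j) (hjk : j < k) (hk : k ≤ n) :
    1 / 3 * Real.log (n + 1) ^ (-(1 / 2) : ℝ) * (Real.exp (-j) + Real.exp (-k)) ≤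
      hValue j - hValue k := by
  have hj' : (1 : ℝ) ≤ j := by exact_mod_cast hj
  have hjk' : (j : ℝ) + 1 ≤ k := by exact_mod_cast hjk
  have hk' : (k : ℝ) ≤ n := by exact_mod_cast hk
  have hlog : 0 < Real.log ((j : ℝ) + 1) := Real.log_pos (by linarith)
  have h1 : Real.log ((n : ℝ) + 1) ^ (-(1 / 2) : ℝ) ≤ Real.log ((j : ℝ) + 1) ^ (-(1 / 2) : ℝ) :=
    Real.rpow_le_rpow_of_nonpos hlog (Real.log_le_log (by linarith) (by linarith)) (by norm_num)
  have h2 : Real.log ((k : ℝ) + 1) ^ (-(1 / 2) : ℝ) ≤ Real.log ((j : ℝ) + 1) ^ (-(1 / 2) : ℝ) :=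
    Real.rpow_le_rpow_of_nonpos hlog (Real.log_le_log (by linarith) (by linarith)) (by norm_num)
  have h3 : Real.exp (-k) ≤ Real.exp (-j) / 2 := by
    have h4 : Real.exp (-k) ≤ Real.exp (-j) * Real.exp (-1) := by
      rw [← Real.exp_add]; exact Real.exp_le_exp.2 (by linarith)
    have h5 : Real.exp (-1) ≤ 1 / 2 := by
      rw [Real.exp_neg, ← one_div]
      exact one_div_le_one_div_of_le (by norm_num) (by linarith [Real.add_one_le_exp (1 : ℝ)])
    nlinarith [Real.exp_pos (-(j : ℝ))]
  have h0 : 0 ≤ Real.log ((n : ℝ) + 1) ^ (-(1 / 2) : ℝ) :=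
    Real.rpow_nonneg (Real.log_nonneg (by linarith)) _
  unfold hValue
  set A := Real.log ((n : ℝ) + 1) ^ (-(1 / 2) : ℝ)
  set B := Real.log ((j : ℝ) + 1) ^ (-(1 / 2) : ℝ)
  set C := Real.log ((k : ℝ) + 1) ^ (-(1 / 2) : ℝ)
  have hk0 := Real.exp_pos (-(k : ℝ))
  calc 1 / 3 * A * (Real.exp (-j) + Real.exp (-k))
      = A * ((Real.exp (-j) + Real.exp (-k)) / 3) := by ring
    _ ≤ A * (Real.exp (-j) - Real.exp (-k)) := by gcongr; linarith
    _ ≤ B * (Real.exp (-j) - Real.exp (-k)) := by gcongr; linarith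
    _ ≤ _ := by nlinarith

/-- The values decrease in the index, so `hValue k - hValue j` has the sign of `j - k` and the
product is positive off `j = k`; `sin x ≤ x` removes the sine. -/
theorem hilbertKernel_mul_hValue_sub_ge {n j k : ℕ} (hj : 1 ≤ j) (hk : 1 ≤ k) (hjn : j ≤ n)
    (hkn : k ≤ n) :
    1 / 3 * Real.log (n + 1) ^ (-(1 / 2) : ℝ) * (1 / |(j : ℝ) - k|) ≤
      hilbertKernel j (-k) * (hValue k - hValue j) := by
  have hneg : (j : ℤ) * (-k) < 0 := by
    have : (0 : ℤ) < j * k := by positivity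
    linarith
  have hs := sin_half_add_exp_pos (j : ℝ) (k : ℝ)
  have hle := Real.sin_le (x := (Real.exp (-|(j : ℝ)|) + Real.exp (-|(k : ℝ)|)) / 2) (by positivity)
  rw [hilbertKernel, if_pos hneg]
  push_cast
  rw [abs_neg]
  rw [Nat.abs_cast, Nat.abs_cast] at hs hle ⊢
  set s := Real.sin ((Real.exp (-(j : ℝ)) + Real.exp (-(k : ℝ))) / 2)
  set A := Real.log ((n : ℝ) + 1) ^ (-(1 / 2) : ℝ) with hA
  have h0 : 0 ≤ A :=
    Real.rpow_nonneg (Real.log_nonneg (by linarith [Nat.cast_nonneg (α := ℝ) n])) _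
  have main : ∀ D V : ℝ, 0 < D →
      1 / 3 * A * (Real.exp (-(j : ℝ)) + Real.exp (-(k : ℝ))) ≤ V →
      1 / 3 * A * (1 / D) ≤ 1 / (D * (2 * s)) * V := by
    intro D V hD hV
    rw [mul_one_div, one_div_mul_eq_div (D * (2 * s)), div_le_div_iff₀ hD (by positivity)]
    calc 1 / 3 * A * (D * (2 * s)) = D * (1 / 3 * A * (2 * s)) := by ring
      _ ≤ D * (1 / 3 * A * (Real.exp (-(j : ℝ)) + Real.exp (-(k : ℝ)))) := by
        gcongr; linarith
      _ ≤ D * V := by gcongr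
      _ = V * D := by ring
  rcases lt_trichotomy j k with h | h | h
  · have hlt : (j : ℝ) < k := by exact_mod_cast h
    rw [abs_of_neg (by linarith)]
    refine (main _ _ (by linarith) (exp_sub_mul_le_hValue_sub hj h hkn)).trans_eq ?_
    rw [show (-((j : ℝ) - k)) * (2 * s) = -(((j : ℝ) + -k) * (2 * s)) by ring,
      one_div_neg_eq_neg_one_div]
    ring
  · subst h; simp
  · have hlt : (k : ℝ) < j := by exact_mod_cast h
    rw [abs_of_pos (by linarith), ← sub_eq_add_neg]
    refine main _ _ (by linarith) ?_
    rw [add_comm (Real.exp _)]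
    exact exp_sub_mul_le_hValue_sub hk h hjn

/-- The indices `{-n, …, n}` of a basis of `ℓ²_{2n+1}`. -/
def centeredIndex (n : ℕ) (a : Fin (2 * n + 1)) : ℤ := (a : ℤ) - n

theorem centeredIndex_injective (n : ℕ) : Function.Injective (centeredIndex n) := by
  intro a b h
  unfold centeredIndex at h
  exact Fin.ext (by omega)

theorem abs_eigAngle {a : ℤ} (ha : a ≠ 0) : |eigAngle a| = Real.exp (-(a.natAbs : ℕ)) := by
  rw [eigAngle, abs_mul, abs_of_pos (Real.exp_pos _), Nat.cast_natAbs, Int.cast_abs]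
  rcases lt_or_gt_of_ne ha with h | h
  · simp [Int.sign_eq_neg_one_of_neg h]
  · simp [Int.sign_eq_one_of_pos h]

theorem IsPeriodicExtension.apply_eigAngle {h : ℝ → ℝ} (hh : IsPeriodicExtension h) {a : ℤ}
    (ha : a ≠ 0) : h (eigAngle a) = hValue a.natAbs := by
  rw [← hLocal_of_abs_eq (abs_eigAngle ha)]
  refine hh.eqOn ?_
  rw [Set.mem_Icc, ← abs_le, abs_eigAngle ha, ← Real.exp_neg, Real.exp_le_exp, neg_le_neg_iff]
  exact_mod_cast Int.natAbs_pos.2 ha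

/-- The commutator of the kernel with the diagonal operator of the values of `h` is large. -/
theorem log_le_norm_commutator {h : ℝ → ℝ} (hh : IsPeriodicExtension h) {n : ℕ} (hn : 0 < n) :
    1 / 3 * Real.log (n + 1) ^ (-(1 / 2) : ℝ) * Real.log n ≤
      ‖matOp (Matrix.of fun a b : Fin (2 * n + 1) =>
        (hilbertKernel (centeredIndex n a) (centeredIndex n b) : ℂ) *
          ((h (eigAngle (centeredIndex n b)) : ℂ) - h (eigAngle (centeredIndex n a))))‖ := by
  set M : Matrix (Fin (2 * n + 1)) (Fin (2 * n + 1)) ℂ := Matrix.of fun a b =>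
    (hilbertKernel (centeredIndex n a) (centeredIndex n b) : ℂ) *
      ((h (eigAngle (centeredIndex n b)) : ℂ) - h (eigAngle (centeredIndex n a))) with hM
  -- Rows are taken at the indices `1, …, n` and columns at `-1, …, -n`, the block on which all
  -- entries are nonnegative.
  let p : Fin n ↪ Fin (2 * n + 1) :=
    ⟨fun j => ⟨n + (j + 1), by omega⟩, fun i j hij => by
      rw [Fin.mk.injEq] at hij; exact Fin.ext (by omega)⟩
  let q : Fin n ↪ Fin (2 * n + 1) :=
    ⟨fun j => ⟨n - (j + 1), by omega⟩, fun i j hij => by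
      rw [Fin.mk.injEq] at hij; exact Fin.ext (by omega)⟩
  have hp : ∀ j, centeredIndex n (p j) = ((j + 1 : ℕ) : ℤ) := by
    intro j
    change ((n + (j + 1) : ℕ) : ℤ) - n = _
    omega
  have hq : ∀ j, centeredIndex n (q j) = -((j + 1 : ℕ) : ℤ) := by
    intro j
    change ((n - (j + 1) : ℕ) : ℤ) - n = _
    omega
  have hentry : ∀ j k : Fin n, M (p j) (q k) =
      ((hilbertKernel ((j + 1 : ℕ) : ℤ) (-((k + 1 : ℕ) : ℤ)) *
        (hValue (k + 1) - hValue (j + 1)) : ℝ) : ℂ) := by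
    intro j k
    rw [hM, Matrix.of_apply, hp, hq, hh.apply_eigAngle (by omega), hh.apply_eigAngle (by omega),
      Int.natAbs_neg, Int.natAbs_natCast, Int.natAbs_natCast]
    push_cast
    rfl
  have hnorm := norm_sum_le_card_mul_norm_matOp M (Finset.univ.map p) (Finset.univ.map q)
    (n := n) (by simp) (by simp)
  simp only [Finset.sum_map, hentry, ← Complex.ofReal_sum] at hnorm
  rw [Complex.norm_real] at hnorm
  have hn' : (0 : ℝ) < n := by exact_mod_cast hn
  set A := Real.log ((n : ℝ) + 1) ^ (-(1 / 2) : ℝ)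
  have h0 : 0 ≤ A := Real.rpow_nonneg (Real.log_nonneg (by linarith)) _
  have hrow : ∀ j : Fin n, 1 / 3 * A * Real.log n ≤
      ∑ k : Fin n, hilbertKernel ((j + 1 : ℕ) : ℤ) (-((k + 1 : ℕ) : ℤ)) *
        (hValue (k + 1) - hValue (j + 1)) := by
    intro j
    calc 1 / 3 * A * Real.log n
        ≤ 1 / 3 * A * ∑ k ∈ Finset.range n, 1 / |((j : ℕ) : ℝ) - k| := by
          gcongr; exact log_le_sum_inv_abs_sub j.2
      _ = ∑ k : Fin n, 1 / 3 * A * (1 / |((j : ℕ) : ℝ) - ((k : ℕ) : ℝ)|) := by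
          rw [Finset.sum_range, Finset.mul_sum]
      _ ≤ _ := by
          refine Finset.sum_le_sum fun k _ => ?_
          have := hilbertKernel_mul_hValue_sub_ge (n := n) (j := j + 1) (k := k + 1)
            (by omega) (by omega) (by omega) (by omega)
          refine le_of_eq_of_le ?_ this
          push_cast
          rw [add_sub_add_right_eq_sub]
  have hsum := Finset.sum_le_sum fun j (_ : j ∈ Finset.univ) => hrow j
  rw [Finset.sum_const, Finset.card_univ, Fintype.card_fin, nsmul_eq_mul] at hsum
  exact le_of_mul_le_mul_left (hsum.trans ((le_abs_self _).trans hnorm)) hn'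

/-- From `n + 1 ≤ n^4`; the factor is `4^{-1/2} = 1/2`. -/
theorem rpow_log_le {n : ℕ} (hn : 2 ≤ n) :
    1 / 2 * Real.log n ^ (1 / 2 : ℝ) ≤ Real.log (n + 1) ^ (-(1 / 2) : ℝ) * Real.log n := by
  have hn' : (2 : ℝ) ≤ n := by exact_mod_cast hn
  have hL : 0 < Real.log n := Real.log_pos (by linarith)
  have h1 : Real.log ((n : ℝ) + 1) ≤ 4 * Real.log n := by
    rw [show (4 : ℝ) * Real.log n = Real.log ((n : ℝ) ^ 4) by rw [Real.log_pow]; norm_num]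
    refine Real.log_le_log (by linarith) ?_
    nlinarith [pow_le_pow_right₀ (by linarith : (1 : ℝ) ≤ n) (by norm_num : 2 ≤ 4)]
  have h2 : (4 * Real.log n) ^ (-(1 / 2) : ℝ) ≤ Real.log (n + 1) ^ (-(1 / 2) : ℝ) :=
    Real.rpow_le_rpow_of_nonpos (Real.log_pos (by linarith)) h1 (by norm_num)
  have h3 : (4 : ℝ) ^ (-(1 / 2) : ℝ) = 1 / 2 := by
    rw [show (4 : ℝ) = 2 ^ (2 : ℝ) by norm_num, ← Real.rpow_mul (by norm_num)]
    norm_num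
  have h4 : Real.log n ^ (-(1 / 2) : ℝ) * Real.log n = Real.log n ^ (1 / 2 : ℝ) := by
    nth_rewrite 2 [← Real.rpow_one (Real.log n)]
    rw [← Real.rpow_add hL]
    norm_num
  calc 1 / 2 * Real.log n ^ (1 / 2 : ℝ)
      = (4 * Real.log n) ^ (-(1 / 2) : ℝ) * Real.log n := by
        rw [Real.mul_rpow (by norm_num) hL.le, h3, mul_assoc, h4]
    _ ≤ _ := by gcongr

/-! ### Assembling the two unitaries -/

/-- `cfc g U` is the function `g` of the normal operator `U`; only the values of `g` on the
spectrum of `U`, a subset of the unit circle when `U` is unitary, matter. -/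
theorem theorem4p2 (h : ℝ → ℝ) (hh : IsPeriodicExtension h)
    (g : ℂ → ℂ) (hg : ∀ θ : ℝ, g (Complex.exp (Complex.I * (θ : ℂ))) = (h θ : ℂ)) :
    ∃ c : ℝ, 0 < c ∧ ∀ n : ℕ, 3 ≤ n →
      ∃ H K : OpEll2 (2 * n + 1),
        H ∈ unitary (OpEll2 (2 * n + 1)) ∧ K ∈ unitary (OpEll2 (2 * n + 1)) ∧
        H ≠ K ∧ spectrum ℂ H = spectrum ℂ K ∧ (1 : ℂ) ∈ spectrum ℂ H ∧
        c * (Real.log (n : ℝ)) ^ (1 / 2 : ℝ) * ‖K - H‖ ≤ ‖cfc g K - cfc g H‖ := by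
  have hpi := Real.pi_pos
  -- `‖K - H‖ ≤ 8πt` and `‖g(K) - g(H)‖ ≥ t (log n)^{1/2} / 12`, with ratio `1/(96π)`.
  refine ⟨1 / (96 * Real.pi), by positivity, fun n hn => ?_⟩
  have hn' : (3 : ℝ) ≤ n := by exact_mod_cast hn
  set d : Fin (2 * n + 1) → ℂ := fun a => Complex.exp (Complex.I * eigAngle (centeredIndex n a))
    with hd
  set X : Matrix (Fin (2 * n + 1)) (Fin (2 * n + 1)) ℂ :=
    Matrix.of fun a b => (hilbertKernel (centeredIndex n a) (centeredIndex n b) : ℂ) with hX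
  have hXsa : IsSelfAdjoint (matOp X) := by
    rw [IsSelfAdjoint, matOp, ← map_star]
    congr 1
    ext a b
    simp [hX, Matrix.star_apply, hilbertKernel_comm (centeredIndex n b)]
  have hdn : ∀ a, ‖d a‖ = 1 := by
    intro a
    change ‖Complex.exp (Complex.I * eigAngle (centeredIndex n a))‖ = 1
    rw [mul_comm Complex.I]
    exact Complex.norm_exp_ofReal_mul_I _
  have hH := diagOp_mem_unitary hdn
  obtain ⟨u, hu, t, ht, hut⟩ := exists_unitary_conj_commutator hXsa
  have hcfcH : cfc g (diagOp d) = diagOp fun a => (h (eigAngle (centeredIndex n a)) : ℂ) := by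
    rw [cfc_diagOp]
    congr 1
    ext a
    exact hg _
  have hcfcK : cfc g (u * diagOp d * star u) = u * cfc g (diagOp d) * star u :=
    cfc_unitary_conj hu (isStarNormal_of_mem_unitary hH)
      ((finite_spectrum_diagOp d).continuousOn g)
  have h1 := (hut (diagOp d)).1
  have h2 := (hut (cfc g (diagOp d))).2
  rw [matOp_commutator_diagOp] at h1
  rw [← hcfcK, hcfcH, matOp_commutator_diagOp, ← hcfcH] at h2
  have h3 : ‖u * diagOp d * star u - diagOp d‖ ≤ 8 * (t * Real.pi) :=
    h1.trans (by gcongr; exact norm_commutator_unitary_le (centeredIndex_injective n))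
  have h4 := (log_le_norm_commutator hh (by omega : 0 < n))
  have h5 := rpow_log_le (by omega : 2 ≤ n)
  have hLpos : 0 < Real.log (n : ℝ) ^ (1 / 2 : ℝ) :=
    Real.rpow_pos_of_pos (Real.log_pos (by linarith)) _
  have h6 : t * (1 / 6 * Real.log (n : ℝ) ^ (1 / 2 : ℝ)) ≤
      2 * ‖cfc g (u * diagOp d * star u) - cfc g (diagOp d)‖ := by
    refine le_trans ?_ h2
    gcongr
    refine le_trans ?_ h4
    linarith
  refine ⟨diagOp d, u * diagOp d * star u, hH, ?_, ?_, ?_, ?_, ?_⟩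
  · exact mul_mem (mul_mem hu hH) (Unitary.star_mem hu)
  · intro heq
    rw [← heq, sub_self, norm_zero, mul_zero] at h6
    exact absurd h6 (not_le.2 (by positivity))
  · exact (Unitary.spectrum_star_right_conjugate (U := ⟨u, hu⟩)).symm
  -- The middle basis vector has index `0`, where the sign factor makes the angle `0`.
  · have h0 : d ⟨n, by omega⟩ = 1 := by simp [hd, centeredIndex, eigAngle]
    rw [← h0]
    exact mem_spectrum_diagOp d _
  · generalize ‖u * diagOp d * star u - diagOp d‖ = x at *
    generalize ‖cfc g (u * diagOp d * star u) - cfc g (diagOp d)‖ = y at *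
    calc 1 / (96 * Real.pi) * Real.log (n : ℝ) ^ (1 / 2 : ℝ) * x
        ≤ 1 / (96 * Real.pi) * Real.log (n : ℝ) ^ (1 / 2 : ℝ) * (8 * (t * Real.pi)) := by
          gcongr
      _ = t * (1 / 6 * Real.log (n : ℝ) ^ (1 / 2 : ℝ)) / 2 := by field_simp; norm_num
      _ ≤ y := by linarith
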